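/- Let $n$, $a$, $c$ be positive integers, let $S=\mathbb{C}[x_1,\dots,x_n]$, and for each positive integer $k$ put $p_k=x_1^k+\dots+x_n^k$. Let $R=S/(p_a,p_{a+1},\dots,p_{a+c-1})$, and let $\mathfrak{m}$ be the ideal of $R$ generated by the images of $x_1,\dots,x_n$, which is a maximal ideal of $R$ (the origin). A prime ideal $\mathfrak{p}$ of $R$ is called a singular point if the localization $R_{\mathfrak{p}}$ is not a regular local ring. Then $R$ has an isolated singular point at the origin: the set of singular points in $\operatorname{Spec} R$ is exactly $\{\mathfrak{m}\}$, except in the degenerate cases where $a=1$ and moreover $c=1$ or $n=1$. In those degenerate cases $R$ has no singular point at all. In particular, in all cases $R_{\mathfrak{p}}$ is a regular local ring for every prime ideal $\mathfrak{p}\neq\mathfrak{m}$ of $R$. -/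

import Mathlib

/-- The singular locus of a commutative ring `R`: the primes `p` of `R` for which the localization
`R_p` is not a regular local ring. -/
def singularLocus (R : Type*) [CommRing R] : Set (PrimeSpectrum R) :=
  {p | ¬ IsRegularLocalRing (Localization.AtPrime p.asIdeal)}

/-- The ideal `(p_a, p_{a+1}, …, p_{a+c-1})` of `ℂ[x_1, …, x_n]`, where
`p_k = x_1 ^ k + ⋯ + x_n ^ k`. -/
noncomputable def consecutivePowerSumIdeal (n a c : ℕ) : Ideal (MvPolynomial (Fin n) ℂ) :=
  Ideal.span (Set.range fun i : Fin c => MvPolynomial.psum (Fin n) ℂ (a + (i : ℕ)))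

/-- The ring `ℂ[x_1, …, x_n] / (p_a, p_{a+1}, …, p_{a+c-1})`. -/
abbrev ConsecutivePowerSumRing (n a c : ℕ) : Type :=
  MvPolynomial (Fin n) ℂ ⧸ consecutivePowerSumIdeal n a c

/-! Away from the origin this is the Jacobian criterion. At a prime `p ≠ m` the images of the
variables in the residue field form a nonzero point `z`. If `z` had fewer than `c` distinct nonzero
coordinates, a polynomial `q` of degree `< c` vanishing at all of them but one would make `∑ z_j^a
q(z_j)` a positive integer times one nonzero term, although this sum is a combination of the
vanishing power sums (`le_card_image_erase_zero`). A relation between the gradients is then a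
polynomial of degree `< c` with at least `c` roots, hence trivial
(`linearIndependent_gradient_psum`).

At the origin only `p_1` has a nonzero gradient, so the tangent space has dimension `n`, or `n - 1`
if `a = 1`. The dimension of `R` is smaller unless `p_1` alone generates the ideal, which is the
degenerate case.

Differentials at a prime, closed or not, are encoded by ring homomorphisms to square-zero extensions
of its residue field. -/

open IsLocalRing

/-! ### Regularity of quotients through cotangent spaces. -/

section Cotangent

variable {A ι : Type*} [CommRing A]

/-- The map induced on cotangent spaces by a ring homomorphism from a local ring `A` to the trivial
square-zero extension of its residue field by a finite power of it. -/
noncomputable def cotangentSpaceLift [IsLocalRing A]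
    (φ : A →+* TrivSqZeroExt (ResidueField A) (ι → ResidueField A))
    (hφ : ∀ a, (φ a).fst = residue A a) :
    CotangentSpace A →ₗ[ResidueField A] (ι → ResidueField A) :=
  LinearMap.extendScalarsOfSurjective (R := A) residue_surjective <|
    Ideal.Cotangent.lift (I := maximalIdeal A)
      { toFun x := (φ x).snd
        map_add' x y := by simp
        map_smul' a x := by
          have hx : residue A (x : A) = 0 := (residue_eq_zero_iff _).2 x.2
          ext i
          simp [hφ, hx, Algebra.smul_def] }
      (fun x y => by
        have hx : residue A (x : A) = 0 := (residue_eq_zero_iff _).2 x.2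
        have hy : residue A (y : A) = 0 := (residue_eq_zero_iff _).2 y.2
        simp [hφ, hx, hy])

lemma cotangentSpaceLift_toCotangent [IsLocalRing A]
    (φ : A →+* TrivSqZeroExt (ResidueField A) (ι → ResidueField A))
    (hφ : ∀ a, (φ a).fst = residue A a) (x : maximalIdeal A) :
    cotangentSpaceLift φ hφ ((maximalIdeal A).toCotangent x) = (φ x).snd := rfl

/-- A quotient of a regular local ring by elements that are linearly independent in the cotangent
space is regular, as soon as its dimension is not too small. -/
lemma IsRegularLocalRing.of_surjective_of_linearIndependent [IsRegularLocalRing A]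
    {B : Type*} [CommRing B] [IsLocalRing B] [IsNoetherianRing B]
    (π : A →+* B) (hπ : Function.Surjective π) [Fintype ι] (f : ι → maximalIdeal A)
    (hf : ∀ i, π (f i) = 0)
    (hli : LinearIndependent (ResidueField A) fun i => (maximalIdeal A).toCotangent (f i))
    (hdim : ringKrullDim A ≤ ringKrullDim B + Fintype.card ι) : IsRegularLocalRing B := by
  set κ := ResidueField A
  set W : Submodule κ (CotangentSpace A) :=
    Submodule.span κ (Set.range fun i => (maximalIdeal A).toCotangent (f i))
  have hW : Module.finrank κ W = Fintype.card ι := finrank_span_eq_card hli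
  have hV := Submodule.finrank_quotient_add_finrank W
  have hd : (Module.finrank κ (CotangentSpace A) : WithBot ℕ∞) = ringKrullDim A :=
    (IsRegularLocalRing.iff_finrank_cotangentSpace A).1 inferInstance
  -- By Nakayama, lifts `y` of a basis modulo `W` generate `maximalIdeal A` together with the `f i`.
  -- The `f i` die in `B`, so the images of the `y i` generate its maximal ideal.
  let b := Module.finBasis κ (CotangentSpace A ⧸ W)
  have hsurj : Function.Surjective fun x : maximalIdeal A =>
      W.mkQ ((maximalIdeal A).toCotangent x) :=
    (Submodule.mkQ_surjective W).comp (Ideal.toCotangent_surjective _)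
  choose y hy using fun i => hsurj (b i)
  have hspan : Submodule.span κ
      ((maximalIdeal A).toCotangent '' (Set.range f ∪ Set.range y)) = ⊤ := by
    rw [Set.image_union, ← Set.range_comp, ← Set.range_comp, Submodule.span_union]
    change W ⊔ _ = ⊤
    rw [← Submodule.map_mkQ_eq_top, Submodule.map_span, ← Set.range_comp]
    have : W.mkQ ∘ (maximalIdeal A).toCotangent ∘ y = b := funext hy
    rw [this, b.span_eq]
  rw [CotangentSpace.span_image_eq_top_iff] at hspan
  have hmA : Ideal.span (Set.range (fun i => (f i : A)) ∪ Set.range fun i => (y i : A)) =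
      maximalIdeal A := by
    have := congrArg (Submodule.map (maximalIdeal A).subtype) hspan
    rw [Submodule.map_span, Set.image_union, ← Set.range_comp, ← Set.range_comp,
      Submodule.map_top, Submodule.range_subtype] at this
    exact this
  have hmB : maximalIdeal B = Ideal.span (Set.range fun i => π (y i)) := by
    refine (map_maximalIdeal_of_surjective π hπ).symm.trans ?_
    refine (congrArg (Ideal.map π) hmA.symm).trans ?_
    rw [Ideal.map_span, Set.image_union, ← Set.range_comp, ← Set.range_comp,
      Ideal.span_union]
    refine sup_eq_right.2 ?_
    rw [Ideal.span_le]
    rintro _ ⟨i, rfl⟩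
    simp [hf]
  refine IsRegularLocalRing.of_spanFinrank_maximalIdeal_le B ?_
  have h1 : (maximalIdeal B).spanFinrank ≤ Module.finrank κ (CotangentSpace A ⧸ W) := by
    rw [hmB]
    refine (Submodule.spanFinrank_span_le_ncard_of_finite (Set.finite_range _)).trans ?_
    rw [← Nat.card_coe_set_eq]
    exact (Finite.card_range_le _).trans (by simp)
  rw [← hd, ← hV, hW, Nat.cast_add] at hdim
  refine (Nat.cast_le.2 h1).trans ?_
  obtain ⟨x, hx⟩ := WithBot.ne_bot_iff_exists.1 (ringKrullDim_ne_bot (R := B))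
  rw [← hx] at hdim ⊢
  have hdim' : ((Module.finrank κ (CotangentSpace A ⧸ W) : ℕ) : ℕ∞) + (Fintype.card ι : ℕ) ≤
      x + (Fintype.card ι : ℕ) := by exact_mod_cast hdim
  exact_mod_cast (ENat.add_le_add_iff_right (ENat.natCast_ne_top _)).1 hdim'

end Cotangent

/-! ### Differentials at a prime and the Jacobian criterion. -/

section Prime

variable {R ι : Type*} [CommRing R] (p : Ideal R) [p.IsPrime]

/-- The extension to `R_p` of a ring homomorphism from `R` to a trivial square-zero extension of
`κ(p)` which lifts the canonical one. -/
noncomputable def trivSqZeroExtLocalizationLift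
    (φ : R →+* TrivSqZeroExt p.ResidueField (ι → p.ResidueField))
    (hφ : ∀ a, (φ a).fst = algebraMap R p.ResidueField a) :
    Localization.AtPrime p →+* TrivSqZeroExt p.ResidueField (ι → p.ResidueField) :=
  IsLocalization.lift (M := p.primeCompl) (g := φ) fun y => by
    rw [TrivSqZeroExt.isUnit_iff_isUnit_fst, hφ, isUnit_iff_ne_zero, Ne,
      Ideal.algebraMap_residueField_eq_zero]
    exact y.2

lemma trivSqZeroExtLocalizationLift_algebraMap
    (φ : R →+* TrivSqZeroExt p.ResidueField (ι → p.ResidueField))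
    (hφ : ∀ a, (φ a).fst = algebraMap R p.ResidueField a) (a : R) :
    trivSqZeroExtLocalizationLift p φ hφ (algebraMap _ _ a) = φ a :=
  IsLocalization.lift_eq _ _

lemma fst_trivSqZeroExtLocalizationLift
    (φ : R →+* TrivSqZeroExt p.ResidueField (ι → p.ResidueField))
    (hφ : ∀ a, (φ a).fst = algebraMap R p.ResidueField a) (a : Localization.AtPrime p) :
    (trivSqZeroExtLocalizationLift p φ hφ a).fst = residue _ a := by
  have h : ((TrivSqZeroExt.fstHom p.ResidueField p.ResidueField
      (ι → p.ResidueField)).toRingHom.comp (trivSqZeroExtLocalizationLift p φ hφ)) =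
      residue (Localization.AtPrime p) := by
    refine IsLocalization.ringHom_ext p.primeCompl (RingHom.ext fun r => ?_)
    change (trivSqZeroExtLocalizationLift p φ hφ (algebraMap _ _ r)).fst = _
    rw [trivSqZeroExtLocalizationLift_algebraMap, hφ]
    rfl
  exact congrArg (fun g => g a) h

/-- Independence can be tested after applying the linear map that `φ` induces on the cotangent
space. -/
lemma linearIndependent_toCotangent_of_trivSqZeroExt
    (φ : R →+* TrivSqZeroExt p.ResidueField (ι → p.ResidueField))
    (hφ : ∀ a, (φ a).fst = algebraMap R p.ResidueField a)
    {κ : Type*} (f : κ → maximalIdeal (Localization.AtPrime p)) (g : κ → R)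
    (hfg : ∀ k, (f k : Localization.AtPrime p) = algebraMap _ _ (g k))
    (hli : LinearIndependent p.ResidueField fun k => (φ (g k)).snd) :
    LinearIndependent p.ResidueField
      fun k => (maximalIdeal (Localization.AtPrime p)).toCotangent (f k) := by
  refine LinearIndependent.of_comp (cotangentSpaceLift (trivSqZeroExtLocalizationLift p φ hφ)
    (fst_trivSqZeroExtLocalizationLift p φ hφ)) ?_
  convert hli using 2 with k
  rw [Function.comp_apply, cotangentSpaceLift_toCotangent, hfg,
    trivSqZeroExtLocalizationLift_algebraMap]

/-- A prime of a ring of dimension less than `d` at which `d` elements have linearly independent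
differentials is singular. -/
lemma not_isRegularLocalRing_of_trivSqZeroExt [IsNoetherianRing R] {d : ℕ}
    (hdim : ringKrullDim R < d)
    (φ : R →+* TrivSqZeroExt p.ResidueField (ι → p.ResidueField))
    (hφ : ∀ a, (φ a).fst = algebraMap R p.ResidueField a)
    (g : Fin d → R) (hg : ∀ k, g k ∈ p)
    (hli : LinearIndependent p.ResidueField fun k => (φ (g k)).snd) :
    ¬ IsRegularLocalRing (Localization.AtPrime p) := by
  intro h
  rw [IsRegularLocalRing.iff_finrank_cotangentSpace] at h
  have hli' := linearIndependent_toCotangent_of_trivSqZeroExt p φ hφ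
    (fun k => ⟨algebraMap _ _ (g k),
      (IsLocalization.AtPrime.to_map_mem_maximal_iff _ p _).2 (hg k)⟩) g (fun _ => rfl) hli
  have hle := hli'.fintype_card_le_finrank
  rw [Fintype.card_fin] at hle
  have h2 : ringKrullDim (Localization.AtPrime p) ≤ ringKrullDim R := by
    rw [IsLocalization.AtPrime.ringKrullDim_eq_height p]
    exact Ideal.height_le_ringKrullDim_of_isPrime
  have h3 : (d : WithBot ℕ∞) ≤ Module.finrank (ResidueField (Localization.AtPrime p))
      (CotangentSpace (Localization.AtPrime p)) := Nat.cast_le.2 hle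
  exact absurd (h3.trans (h.le.trans h2)) (not_le.2 hdim)

end Prime

/-- The Jacobian criterion: a prime of the quotient of a regular ring by `c` elements whose
differentials are linearly independent at that prime is a regular point. -/
lemma isRegularLocalRing_localization_quotient {S ι κ : Type*} [CommRing S] [IsRegularRing S]
    [Fintype κ] (f : κ → S) {I : Ideal S} (hI : I = Ideal.span (Set.range f))
    (p : Ideal (S ⧸ I)) [p.IsPrime]
    (φ : S →+* TrivSqZeroExt (p.comap (Ideal.Quotient.mk I)).ResidueField
      (ι → (p.comap (Ideal.Quotient.mk I)).ResidueField))
    (hφ : ∀ a, (φ a).fst = algebraMap S _ a)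
    (hli : LinearIndependent (p.comap (Ideal.Quotient.mk I)).ResidueField
      fun k => (φ (f k)).snd) :
    IsRegularLocalRing (Localization.AtPrime p) := by
  set P := p.comap (Ideal.Quotient.mk I) with hP
  have hIP : I ≤ P := fun x hx => by
    rw [hP, Ideal.mem_comap, Ideal.Quotient.eq_zero_iff_mem.2 hx]
    exact p.zero_mem
  have hf (k : κ) : f k ∈ I := hI ▸ Ideal.subset_span ⟨k, rfl⟩
  have hreg : IsRegularLocalRing (Localization.AtPrime P) :=
    IsRegularRing.isRegularLocalRing_localization P
  have : IsNoetherianRing (Localization.AtPrime p) :=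
    IsLocalization.isNoetherianRing p.primeCompl _ inferInstance
  refine IsRegularLocalRing.of_surjective_of_linearIndependent
    (Localization.localRingHom P p (Ideal.Quotient.mk I) rfl)
    (RingHom.surjective_localRingHom_of_surjective _ Ideal.Quotient.mk_surjective p)
    (fun k => ⟨algebraMap _ _ (f k),
      (IsLocalization.AtPrime.to_map_mem_maximal_iff _ P _).2 (hIP (hf k))⟩) (fun k => ?_)
    (linearIndependent_toCotangent_of_trivSqZeroExt P φ hφ _ f (fun _ => rfl) hli) ?_
  · rw [Localization.localRingHom_to_map, Ideal.Quotient.eq_zero_iff_mem.2 (hf k), map_zero]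
  · rw [IsLocalization.AtPrime.ringKrullDim_eq_height P,
      IsLocalization.AtPrime.ringKrullDim_eq_height p]
    -- Krull's height theorem: passing to the quotient by `I` lowers the height by at most the
    -- number of generators.
    have h1 := Ideal.height_le_height_add_spanFinrank_of_le hIP
    rw [hP, Ideal.map_comap_of_surjective _ Ideal.Quotient.mk_surjective, ← hP] at h1
    have h2 : I.spanFinrank ≤ Fintype.card κ := by
      rw [hI]
      refine (Submodule.spanFinrank_span_le_ncard_of_finite (Set.finite_range _)).trans ?_
      rw [← Nat.card_coe_set_eq, ← Nat.card_eq_fintype_card]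
      exact Finite.card_range_le _
    have h3 : P.height ≤ p.height + Fintype.card κ :=
      h1.trans (by gcongr)
    exact_mod_cast h3

/-! ### Common zeros of consecutive power sums over a field. -/

section PowerSums

variable {K σ : Type*} [Field K] [Fintype σ]

lemma sum_pow_mul_eval_eq_zero {a c : ℕ} {z : σ → K}
    (hz : ∀ i : Fin c, ∑ j, z j ^ (a + (i : ℕ)) = 0) (q : Polynomial K) (hq : q.natDegree < c) :
    ∑ j, z j ^ a * q.eval (z j) = 0 := by
  simp_rw [Polynomial.eval_eq_sum_range' hq, Finset.mul_sum]
  rw [Finset.sum_comm]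
  refine Finset.sum_eq_zero fun i hi => ?_
  have := hz ⟨i, Finset.mem_range.1 hi⟩
  simp_rw [pow_add] at this
  calc ∑ j, z j ^ a * (q.coeff i * z j ^ i) = q.coeff i * ∑ j, z j ^ a * z j ^ i := by
        rw [Finset.mul_sum]
        exact Finset.sum_congr rfl fun _ _ => by ring
    _ = 0 := by rw [this, mul_zero]

/-- A nonzero common zero of `c` consecutive power sums has at least `c` distinct nonzero
coordinates. -/
lemma le_card_image_erase_zero [CharZero K] [DecidableEq K] {a c : ℕ} (ha : 1 ≤ a) {z : σ → K}
    (hz : ∀ i : Fin c, ∑ j, z j ^ (a + (i : ℕ)) = 0) (hz0 : ∃ j, z j ≠ 0) :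
    c ≤ ((Finset.univ.image z).erase 0).card := by
  set T := (Finset.univ.image z).erase 0
  by_contra! hlt
  obtain ⟨j₀, hj₀⟩ := hz0
  have hT (j : σ) (hj : z j ≠ 0) : z j ∈ T :=
    Finset.mem_erase.2 ⟨hj, Finset.mem_image_of_mem _ (Finset.mem_univ j)⟩
  -- `q` kills every nonzero value except `z j₀`; zero coordinates are killed by the factor `z j ^
  -- a`, as `a ≥ 1`.
  set q : Polynomial K := ∏ w ∈ T.erase (z j₀), (Polynomial.X - Polynomial.C w)
  have hdeg : q.natDegree < c := by
    rw [Polynomial.natDegree_finsetProd_X_sub_C_eq_card]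
    exact (Finset.card_le_card (Finset.erase_subset _ _)).trans_lt hlt
  have hq0 : q.eval (z j₀) ≠ 0 := by
    rw [Polynomial.eval_prod, Finset.prod_ne_zero_iff]
    intro w hw
    rw [Polynomial.eval_sub, Polynomial.eval_X, Polynomial.eval_C, sub_ne_zero]
    exact (Finset.ne_of_mem_erase hw).symm
  have hsum := sum_pow_mul_eval_eq_zero hz q hdeg
  have hterm (j : σ) : z j ^ a * q.eval (z j) =
      if z j = z j₀ then z j₀ ^ a * q.eval (z j₀) else 0 := by
    by_cases h : z j = z j₀
    · rw [if_pos h, h]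
    · rw [if_neg h]
      by_cases hj : z j = 0
      · rw [hj, zero_pow (by omega), zero_mul]
      · rw [Polynomial.eval_prod, Finset.prod_eq_zero (Finset.mem_erase.2 ⟨h, hT j hj⟩) (by simp),
          mul_zero]
  rw [Finset.sum_congr rfl fun j _ => hterm j] at hsum
  rw [Finset.sum_ite, Finset.sum_const_zero, add_zero, Finset.sum_const, nsmul_eq_mul] at hsum
  refine mul_ne_zero ?_ (mul_ne_zero (pow_ne_zero a hj₀) hq0) hsum
  -- The multiplicity of the value `z j₀` is nonzero in characteristic zero.
  rw [Nat.cast_ne_zero, Finset.card_ne_zero]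
  exact ⟨j₀, by simp⟩

/-- The Jacobian matrix of `c` consecutive power sums has rank `c` at each of their nonzero common
zeros. -/
lemma linearIndependent_gradient_psum [CharZero K] {a c : ℕ} (ha : 1 ≤ a) {z : σ → K}
    (hz : ∀ i : Fin c, ∑ j, z j ^ (a + (i : ℕ)) = 0) (hz0 : ∃ j, z j ≠ 0) :
    LinearIndependent K
      fun (i : Fin c) (j : σ) => ((a + (i : ℕ) : ℕ) : K) * z j ^ (a + (i : ℕ) - 1) := by
  classical
  rw [Fintype.linearIndependent_iff]
  intro s hs k
  -- Column `j` of the relation reads `z j ^ (a - 1) * Q(z j) = 0`, so `Q` vanishes at every nonzero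
  -- coordinate.
  set Q : Polynomial K :=
    ∑ i : Fin c, Polynomial.C (s i * ((a + (i : ℕ) : ℕ) : K)) * Polynomial.X ^ (i : ℕ)
  have hcard := le_card_image_erase_zero ha hz hz0
  have hQ : Q = 0 := by
    refine Polynomial.eq_zero_of_degree_lt_of_eval_finset_eq_zero
      ((Finset.univ.image z).erase 0)
      ((Polynomial.degree_sum_fin_lt _).trans_le (Nat.cast_le.2 hcard)) fun x hx => ?_
    obtain ⟨hx0, hx⟩ := Finset.mem_erase.1 hx
    obtain ⟨j, -, rfl⟩ := Finset.mem_image.1 hx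
    have hj := congrFun hs j
    rw [Finset.sum_apply, Pi.zero_apply] at hj
    refine (mul_eq_zero.1 ?_).resolve_left (pow_ne_zero (a - 1) hx0)
    rw [← hj, Polynomial.eval_finsetSum, Finset.mul_sum]
    refine Finset.sum_congr rfl fun i _ => ?_
    rw [show a + (i : ℕ) - 1 = a - 1 + i by omega]
    simp only [Polynomial.eval_mul, Polynomial.eval_C, Polynomial.eval_pow, Polynomial.eval_X,
      Pi.smul_apply, smul_eq_mul, pow_add]
    ring
  have hcoeff : Q.coeff k = s k * ((a + (k : ℕ) : ℕ) : K) := by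
    simp only [Q, Polynomial.finsetSum_coeff, Polynomial.coeff_C_mul_X_pow, Fin.val_inj]
    simp
  rw [hQ, Polynomial.coeff_zero, eq_comm, mul_eq_zero] at hcoeff
  exact hcoeff.resolve_right (Nat.cast_ne_zero.2 (by omega))

end PowerSums

/-! ### First-order evaluation of polynomials. -/

section TangentVector

variable {k K σ ι : Type*} [CommRing k] [Field K]

/-- The homomorphism evaluating a polynomial to first order at the point `z` along the tangent
vectors with coordinates `v`. -/
noncomputable def evalTrivSqZeroExt (g : k →+* K) (z : σ → K) (v : σ → ι → K) :
    MvPolynomial σ k →+* TrivSqZeroExt K (ι → K) :=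
  MvPolynomial.eval₂Hom ((TrivSqZeroExt.inlHom K (ι → K)).comp g)
    fun i => TrivSqZeroExt.inl (z i) + TrivSqZeroExt.inr (v i)

lemma fst_evalTrivSqZeroExt (g : k →+* K) (z : σ → K) (v : σ → ι → K) (f : MvPolynomial σ k) :
    (evalTrivSqZeroExt g z v f).fst = MvPolynomial.eval₂Hom g z f := by
  have h : ((TrivSqZeroExt.fstHom K K (ι → K)).toRingHom.comp (evalTrivSqZeroExt g z v)) =
      MvPolynomial.eval₂Hom g z := by
    refine MvPolynomial.ringHom_ext (fun r => ?_) fun i => ?_ <;> simp [evalTrivSqZeroExt]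
  exact congrArg (fun e => e f) h

lemma snd_evalTrivSqZeroExt_X (g : k →+* K) (z : σ → K) (v : σ → ι → K) (i : σ) :
    (evalTrivSqZeroExt g z v (MvPolynomial.X i)).snd = v i := by
  simp [evalTrivSqZeroExt]

lemma snd_evalTrivSqZeroExt_psum [Fintype σ] (g : k →+* K) (z : σ → K) (v : σ → ι → K) (d : ℕ) :
    (evalTrivSqZeroExt g z v (MvPolynomial.psum σ k d)).snd =
      ∑ i, ((d : K) * z i ^ (d - 1)) • v i := by
  rw [MvPolynomial.psum, map_sum, TrivSqZeroExt.snd_sum]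
  refine Finset.sum_congr rfl fun i _ => ?_
  rw [map_pow, TrivSqZeroExt.snd_pow, snd_evalTrivSqZeroExt_X, fst_evalTrivSqZeroExt,
    MvPolynomial.eval₂Hom_X', Nat.pred_eq_sub_one, ← Nat.cast_smul_eq_nsmul K, smul_smul]

end TangentVector

/-! ### The power sum ideal and the origin. -/

lemma psum_mem_consecutivePowerSumIdeal {n a c i : ℕ} (hi : i < c) :
    MvPolynomial.psum (Fin n) ℂ (a + i) ∈ consecutivePowerSumIdeal n a c :=
  Ideal.subset_span ⟨⟨i, hi⟩, rfl⟩

lemma consecutivePowerSumIdeal_one_one (c : ℕ) (hc : 1 ≤ c) :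
    consecutivePowerSumIdeal 1 1 c = Ideal.span (Set.range fun _ : Fin 1 =>
      MvPolynomial.psum (Fin 1) ℂ 1) := by
  refine le_antisymm (Ideal.span_le.2 ?_) (Ideal.span_le.2 ?_)
  · rintro _ ⟨i, rfl⟩
    refine Ideal.mem_of_dvd _ (a := MvPolynomial.psum (Fin 1) ℂ 1) ?_ (Ideal.subset_span ⟨0, rfl⟩)
    simp [MvPolynomial.psum, pow_add]
  · rintro _ ⟨-, rfl⟩
    exact psum_mem_consecutivePowerSumIdeal (i := 0) hc

/-- Evaluation at the origin. -/
noncomputable def consecutivePowerSumRingEvalZero {n a c : ℕ} (ha : 1 ≤ a) :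
    ConsecutivePowerSumRing n a c →+* ℂ :=
  Ideal.Quotient.lift _ MvPolynomial.constantCoeff fun f hf => by
    refine (Ideal.span_le (I := RingHom.ker MvPolynomial.constantCoeff)).2 ?_ hf
    rintro _ ⟨i, rfl⟩
    have : a + (i : ℕ) ≠ 0 := by omega
    simp only [SetLike.mem_coe, RingHom.mem_ker, MvPolynomial.psum, map_sum, map_pow,
      MvPolynomial.constantCoeff_X, zero_pow this, Finset.sum_const_zero]

lemma span_X_eq_ker {n a c : ℕ} (ha : 1 ≤ a) :
    Ideal.span (Set.range fun j : Fin n =>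
      Ideal.Quotient.mk (consecutivePowerSumIdeal n a c) (MvPolynomial.X j)) =
      RingHom.ker (consecutivePowerSumRingEvalZero (n := n) (c := c) ha) := by
  refine le_antisymm (Ideal.span_le.2 ?_) fun x hx => ?_
  · rintro _ ⟨j, rfl⟩
    exact MvPolynomial.constantCoeff_X _ j
  · obtain ⟨f, rfl⟩ := Ideal.Quotient.mk_surjective x
    have hf : MvPolynomial.constantCoeff f = 0 := hx
    have hmem : f ∈ Ideal.span (MvPolynomial.X '' (Set.univ : Set (Fin n))) := by
      rw [MvPolynomial.mem_ideal_span_X_image]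
      intro m hm
      by_contra! h
      have hm0 : m = 0 := Finsupp.ext fun i => h i trivial
      rw [MvPolynomial.mem_support_iff, hm0] at hm
      exact hm hf
    have := Ideal.mem_map_of_mem (Ideal.Quotient.mk (consecutivePowerSumIdeal n a c)) hmem
    rwa [Ideal.map_span, Set.image_univ, ← Set.range_comp] at this

lemma span_X_isMaximal {n a c : ℕ} (ha : 1 ≤ a) :
    (Ideal.span (Set.range fun j : Fin n =>
      Ideal.Quotient.mk (consecutivePowerSumIdeal n a c) (MvPolynomial.X j))).IsMaximal := by
  rw [span_X_eq_ker ha]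
  refine RingHom.ker_isMaximal_of_surjective _ fun x => ⟨Ideal.Quotient.mk _ (MvPolynomial.C x),
    MvPolynomial.constantCoeff_C _ x⟩

/-! ### Regular points. -/

/-- The Jacobian criterion for an ideal generated by power sums. -/
lemma isRegularLocalRing_of_linearIndependent_gradient {n c : ℕ} (e : Fin c → ℕ)
    {I : Ideal (MvPolynomial (Fin n) ℂ)}
    (hI : I = Ideal.span (Set.range fun i => MvPolynomial.psum (Fin n) ℂ (e i)))
    (p : Ideal (MvPolynomial (Fin n) ℂ ⧸ I)) [p.IsPrime]
    (hli : LinearIndependent (p.comap (Ideal.Quotient.mk I)).ResidueField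
      fun (i : Fin c) (j : Fin n) => (e i : (p.comap (Ideal.Quotient.mk I)).ResidueField) *
        algebraMap (MvPolynomial (Fin n) ℂ) _ (MvPolynomial.X j) ^ (e i - 1)) :
    IsRegularLocalRing (Localization.AtPrime p) := by
  set P := p.comap (Ideal.Quotient.mk I)
  -- With the standard basis as tangent vectors, the second component of the evaluation is the
  -- gradient.
  refine isRegularLocalRing_localization_quotient _ hI p
    (evalTrivSqZeroExt ((algebraMap (MvPolynomial (Fin n) ℂ) P.ResidueField).comp MvPolynomial.C)
      (fun j => algebraMap (MvPolynomial (Fin n) ℂ) P.ResidueField (MvPolynomial.X j))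
      fun j => Pi.single j 1) (fun f => ?_) ?_
  · rw [fst_evalTrivSqZeroExt]
    have : MvPolynomial.eval₂Hom
        ((algebraMap (MvPolynomial (Fin n) ℂ) P.ResidueField).comp MvPolynomial.C)
        (fun j => algebraMap (MvPolynomial (Fin n) ℂ) P.ResidueField (MvPolynomial.X j)) =
        algebraMap (MvPolynomial (Fin n) ℂ) P.ResidueField :=
      MvPolynomial.ringHom_ext (fun r => by simp) fun i => by simp
    rw [this]
  · convert hli using 2 with i
    rw [snd_evalTrivSqZeroExt_psum]
    ext j
    rw [Finset.sum_apply, Finset.sum_eq_single j (fun b _ hb => by simp [hb.symm]) (by simp)]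
    rw [Pi.smul_apply, Pi.single_eq_same, smul_eq_mul, mul_one]

lemma charZero_residueField {n : ℕ} (P : Ideal (MvPolynomial (Fin n) ℂ)) [P.IsPrime] :
    CharZero P.ResidueField :=
  charZero_of_injective_ringHom
    ((algebraMap (MvPolynomial (Fin n) ℂ) P.ResidueField).comp MvPolynomial.C).injective

lemma isRegularLocalRing_of_exists_X_notMem {n a c : ℕ} (ha : 1 ≤ a)
    (p : Ideal (ConsecutivePowerSumRing n a c)) [p.IsPrime]
    (hp : ∃ j, Ideal.Quotient.mk (consecutivePowerSumIdeal n a c) (MvPolynomial.X j) ∉ p) :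
    IsRegularLocalRing (Localization.AtPrime p) := by
  refine isRegularLocalRing_of_linearIndependent_gradient (fun i : Fin c => a + (i : ℕ))
    (I := consecutivePowerSumIdeal n a c) rfl p ?_
  set P := p.comap (Ideal.Quotient.mk (consecutivePowerSumIdeal n a c)) with hP
  have := charZero_residueField P
  refine linearIndependent_gradient_psum ha (fun i => ?_) ?_
  · have hmem : MvPolynomial.psum (Fin n) ℂ (a + (i : ℕ)) ∈ P := by
      rw [hP, Ideal.mem_comap,
        Ideal.Quotient.eq_zero_iff_mem.2 (psum_mem_consecutivePowerSumIdeal i.2)]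
      exact p.zero_mem
    rw [← Ideal.algebraMap_residueField_eq_zero, MvPolynomial.psum, map_sum] at hmem
    simpa using hmem
  · obtain ⟨j, hj⟩ := hp
    exact ⟨j, by rwa [Ne, Ideal.algebraMap_residueField_eq_zero]⟩

/-- The ideal is generated by the linear form `p_1`, whose gradient `(1, …, 1)` vanishes nowhere. -/
lemma isRegularLocalRing_of_degenerate {n c : ℕ} (hn : 1 ≤ n) (hc : 1 ≤ c) (h : c = 1 ∨ n = 1)
    (p : Ideal (ConsecutivePowerSumRing n 1 c)) [p.IsPrime] :
    IsRegularLocalRing (Localization.AtPrime p) := by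
  refine isRegularLocalRing_of_linearIndependent_gradient (fun _ : Fin 1 => 1) ?_ p ?_
  · rcases h with rfl | rfl
    · refine congrArg (fun g => Ideal.span (Set.range g)) (funext fun i => ?_)
      rw [Fin.val_eq_zero, Nat.add_zero]
    · exact consecutivePowerSumIdeal_one_one c hc
  · rw [linearIndependent_unique_iff]
    intro h0
    simpa using congrFun h0 (⟨0, hn⟩ : Fin n)

/-! ### Singularity of the origin. -/

/-- If `R` has dimension less than `d`, and `d` of the variables restrict to a system of coordinates
on a space of tangent vectors at the origin, then the origin is singular. -/
lemma not_isRegularLocalRing_of_tangentVectors {n a c d : ℕ} (ha : 1 ≤ a)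
    (m : Ideal (ConsecutivePowerSumRing n a c)) [m.IsPrime]
    (hm : ∀ j, Ideal.Quotient.mk (consecutivePowerSumIdeal n a c) (MvPolynomial.X j) ∈ m)
    (hdim : ringKrullDim (ConsecutivePowerSumRing n a c) < d)
    (v : Fin n → Fin d → m.ResidueField) (hv : a = 1 → ∑ j, v j = 0)
    (e : Fin d → Fin n) (he : ∀ i, v (e i) = Pi.single i 1) :
    ¬ IsRegularLocalRing (Localization.AtPrime m) := by
  set g : ℂ →+* m.ResidueField :=
    ((algebraMap (ConsecutivePowerSumRing n a c) m.ResidueField).comp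
      (Ideal.Quotient.mk _)).comp MvPolynomial.C with hg
  -- At the origin the gradient of `p_k` is zero for `k ≥ 2`, so only `p_1` constrains `v`, through
  -- `hv`.
  have hker : ∀ f ∈ consecutivePowerSumIdeal n a c,
      evalTrivSqZeroExt g (fun _ => 0) v f = 0 := by
    intro f hf
    refine (Ideal.span_le (I := RingHom.ker (evalTrivSqZeroExt g (fun _ => 0) v))).2 ?_ hf
    rintro _ ⟨i, rfl⟩
    rw [SetLike.mem_coe, RingHom.mem_ker]
    refine TrivSqZeroExt.ext ?_ ?_
    · have : a + (i : ℕ) ≠ 0 := by omega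
      rw [fst_evalTrivSqZeroExt]
      simp only [MvPolynomial.psum, map_sum, map_pow, MvPolynomial.eval₂Hom_X', zero_pow this,
        Finset.sum_const_zero, TrivSqZeroExt.fst_zero]
    · rw [snd_evalTrivSqZeroExt_psum, ← Finset.smul_sum, TrivSqZeroExt.snd_zero]
      by_cases h1 : a + (i : ℕ) = 1
      · rw [hv (by omega), smul_zero]
      · rw [zero_pow (by omega), mul_zero, zero_smul]
  refine not_isRegularLocalRing_of_trivSqZeroExt m hdim (Ideal.Quotient.lift _ _ hker)
    (fun x => ?_) (fun i => Ideal.Quotient.mk _ (MvPolynomial.X (e i))) (fun i => hm _) ?_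
  · obtain ⟨f, rfl⟩ := Ideal.Quotient.mk_surjective x
    rw [Ideal.Quotient.lift_mk, fst_evalTrivSqZeroExt]
    have : MvPolynomial.eval₂Hom g (fun _ => 0) =
        (algebraMap (ConsecutivePowerSumRing n a c) m.ResidueField).comp
          (Ideal.Quotient.mk _) := by
      refine MvPolynomial.ringHom_ext (fun r => by simp [hg]) fun i => ?_
      rw [MvPolynomial.eval₂Hom_X', RingHom.comp_apply, eq_comm,
        Ideal.algebraMap_residueField_eq_zero]
      exact hm i
    rw [this, RingHom.comp_apply]
  · simp only [Ideal.Quotient.lift_mk, snd_evalTrivSqZeroExt_X, he]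
    exact Pi.linearIndependent_single_one (Fin d) m.ResidueField

/-- A quotient of a polynomial ring in `d` variables over a field by a nonzero ideal has dimension
less than `d`. -/
lemma ringKrullDim_lt_of_surjective {k R : Type*} [Field k] [CommRing R] {d : ℕ}
    (f : MvPolynomial (Fin d) k →+* R) (hf : Function.Surjective f) {q : MvPolynomial (Fin d) k}
    (hq : q ≠ 0) (hfq : f q = 0) : ringKrullDim R < d := by
  have h := ringKrullDim_succ_le_of_surjective f hf (mem_nonZeroDivisors_of_ne_zero hq) hfq
  rw [MvPolynomial.ringKrullDim_of_isNoetherianRing, ringKrullDim_eq_zero_of_field, zero_add,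
    Nat.card_fin] at h
  cases hR : ringKrullDim R with
  | bot => exact WithBot.bot_lt_coe _
  | coe x =>
    rw [hR] at h
    have h' : x + 1 ≤ (d : ℕ∞) := by exact_mod_cast h
    exact_mod_cast (ENat.add_one_le_iff (fun hx => by simp [hx] at h')).1 h'

lemma not_isRegularLocalRing_of_two_le {n a c : ℕ} (hn : 1 ≤ n) (ha : 2 ≤ a) (hc : 1 ≤ c)
    (m : Ideal (ConsecutivePowerSumRing n a c)) [m.IsPrime]
    (hm : ∀ j, Ideal.Quotient.mk (consecutivePowerSumIdeal n a c) (MvPolynomial.X j) ∈ m) :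
    ¬ IsRegularLocalRing (Localization.AtPrime m) := by
  refine not_isRegularLocalRing_of_tangentVectors (by omega) m hm
    (ringKrullDim_lt_of_surjective (Ideal.Quotient.mk _) Ideal.Quotient.mk_surjective
      (q := MvPolynomial.psum (Fin n) ℂ a) (fun h => ?_)
      (Ideal.Quotient.eq_zero_iff_mem.2 (psum_mem_consecutivePowerSumIdeal (i := 0) hc)))
    (fun j => Pi.single j 1) (fun h => by omega) id fun _ => rfl
  -- `p_a` takes the value `n ≠ 0` at `(1, …, 1)`.
  have := congrArg (MvPolynomial.eval fun _ => 1) h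
  simp [MvPolynomial.psum] at this
  omega

/-- The dimension bound obtained by eliminating the first variable by means of the vanishing of the
sum of the variables. -/
lemma ringKrullDim_consecutivePowerSumRing_one_lt {N c : ℕ} (hN : 1 ≤ N) (hc : 2 ≤ c) :
    ringKrullDim (ConsecutivePowerSumRing (N + 1) 1 c) < N := by
  set I := consecutivePowerSumIdeal (N + 1) 1 c
  let ψ : MvPolynomial (Fin N) ℂ →ₐ[ℂ] ConsecutivePowerSumRing (N + 1) 1 c :=
    MvPolynomial.aeval fun j => Ideal.Quotient.mk I (MvPolynomial.X j.succ)
  let ρ : MvPolynomial (Fin (N + 1)) ℂ →ₐ[ℂ] MvPolynomial (Fin N) ℂ :=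
    MvPolynomial.aeval (Fin.cases (-∑ j, MvPolynomial.X j) MvPolynomial.X)
  have hψρ : ψ.comp ρ = Ideal.Quotient.mkₐ ℂ I := by
    refine MvPolynomial.algHom_ext fun i => ?_
    refine Fin.cases ?_ (fun j => ?_) i
    · have h := Ideal.Quotient.eq_zero_iff_mem.2
        (psum_mem_consecutivePowerSumIdeal (n := N + 1) (a := 1) (i := 0) (c := c) (by omega))
      rw [add_zero, MvPolynomial.psum_one, Fin.sum_univ_succ, map_add, map_sum] at h
      simp only [ψ, ρ, AlgHom.comp_apply, MvPolynomial.aeval_X, Fin.cases_zero, map_neg, map_sum,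
        Ideal.Quotient.mkₐ_eq_mk]
      exact (eq_neg_of_add_eq_zero_left h).symm
    · simp [ψ, ρ]
  have hψρ' (f : MvPolynomial (Fin (N + 1)) ℂ) : ψ (ρ f) = Ideal.Quotient.mk I f :=
    congrArg (fun g => g f) hψρ
  refine ringKrullDim_lt_of_surjective ψ.toRingHom (fun x => ?_)
    (q := ρ (MvPolynomial.psum (Fin (N + 1)) ℂ 2)) (fun h => ?_) ?_
  · obtain ⟨f, rfl⟩ := Ideal.Quotient.mk_surjective x
    exact ⟨ρ f, hψρ' f⟩
  · have := congrArg (MvPolynomial.eval fun _ => 1) h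
    simp only [ρ, MvPolynomial.psum, Fin.sum_univ_succ, map_add, map_sum, map_pow,
      MvPolynomial.aeval_X, Fin.cases_zero, Fin.cases_succ, MvPolynomial.eval_X, map_zero,
      Finset.sum_const, Finset.card_univ, Fintype.card_fin, nsmul_eq_mul, mul_one, one_pow,
      neg_sq] at this
    have h' : N ^ 2 + N = 0 := by exact_mod_cast this
    omega
  · exact (hψρ' _).trans (Ideal.Quotient.eq_zero_iff_mem.2
      (psum_mem_consecutivePowerSumIdeal (a := 1) (i := 1) (by omega)))

lemma not_isRegularLocalRing_of_one {n c : ℕ} (hn : 2 ≤ n) (hc : 2 ≤ c)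
    (m : Ideal (ConsecutivePowerSumRing n 1 c)) [m.IsPrime]
    (hm : ∀ j, Ideal.Quotient.mk (consecutivePowerSumIdeal n 1 c) (MvPolynomial.X j) ∈ m) :
    ¬ IsRegularLocalRing (Localization.AtPrime m) := by
  obtain ⟨N, rfl⟩ : ∃ N, n = N + 1 := ⟨n - 1, by omega⟩
  -- The tangent space is the hyperplane `∑ x_j = 0`: the last `N` variables are coordinates on it
  -- and the first is minus their sum.
  refine not_isRegularLocalRing_of_tangentVectors le_rfl m hm
    (ringKrullDim_consecutivePowerSumRing_one_lt (by omega) hc)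
    (Fin.cases (fun _ => -1) fun j => Pi.single j 1) (fun _ => ?_) Fin.succ fun _ => rfl
  ext i
  simp [Fin.sum_univ_succ, Pi.single_apply]

theorem theorem2p6 (n a c : ℕ) (hn : 1 ≤ n) (ha : 1 ≤ a) (hc : 1 ≤ c) :
    ∃ m : PrimeSpectrum (ConsecutivePowerSumRing n a c),
      m.asIdeal = Ideal.span (Set.range fun j : Fin n =>
        Ideal.Quotient.mk (consecutivePowerSumIdeal n a c) (MvPolynomial.X j)) ∧
      m.asIdeal.IsMaximal ∧
      (¬ (a = 1 ∧ (c = 1 ∨ n = 1)) →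
        singularLocus (ConsecutivePowerSumRing n a c) = {m}) ∧
      (a = 1 ∧ (c = 1 ∨ n = 1) →
        singularLocus (ConsecutivePowerSumRing n a c) = ∅) := by
  have hmax := span_X_isMaximal (n := n) (c := c) ha
  refine ⟨⟨_, hmax.isPrime⟩, rfl, hmax, fun h => ?_, ?_⟩
  · refine Set.eq_singleton_iff_unique_mem.2 ⟨?_, fun p hp => ?_⟩
    · have := hmax.isPrime
      by_cases ha1 : a = 1
      · subst ha1
        exact not_isRegularLocalRing_of_one (by omega) (by omega) _
          fun j => Ideal.subset_span ⟨j, rfl⟩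
      · exact not_isRegularLocalRing_of_two_le hn (by omega) hc _
          fun j => Ideal.subset_span ⟨j, rfl⟩
    · have hX (j : Fin n) :
          Ideal.Quotient.mk (consecutivePowerSumIdeal n a c) (MvPolynomial.X j) ∈ p.asIdeal := by
        by_contra hj
        exact hp (isRegularLocalRing_of_exists_X_notMem ha p.asIdeal ⟨j, hj⟩)
      refine PrimeSpectrum.ext (hmax.eq_of_le p.2.ne_top (Ideal.span_le.2 ?_)).symm
      rintro _ ⟨j, rfl⟩
      exact hX j
  · rintro ⟨rfl, h⟩
    exact Set.eq_empty_of_forall_notMem fun p hp =>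
      hp (isRegularLocalRing_of_degenerate hn hc h p.asIdeal)
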